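/- Let $n\ge 1$ and $\mathsf K>0$, let $\Delta^n=\{z\in\mathbb C^n : |z^\alpha|<1 \text{ for } \alpha=1,\dots,n\}$ be the unit polydisc, and let $$\omega=\sqrt{-1}\sum_{\alpha=1}^n\frac{2}{\mathsf K\,(1-|z^\alpha|^2)^2}\,dz^\alpha\wedge d\bar z^\alpha$$ be its complete Kähler–Einstein metric with Ricci curvature $-\mathsf K$. Let $V\subset\Delta^n$ be a nonempty open set and let $\varphi:V\to\mathbb R$ be a smooth function which is a local potential of $\omega$, that is, $\sqrt{-1}\,\partial\bar\partial\varphi=\omega$ on $V$. If the gradient length $$|\partial\varphi|_\omega^2=\sum_{\alpha,\beta=1}^n g^{\alpha\bar\beta}\,\frac{\partial\varphi}{\partial z^\alpha}\,\frac{\partial\varphi}{\partial\bar z^\beta}=\sum_{\alpha=1}^n\frac{\mathsf K\,(1-|z^\alpha|^2)^2}{2}\,\Bigl|\frac{\partial\varphi}{\partial z^\alpha}\Bigr|^2$$ is constant on $V$, where $(g^{\alpha\bar\beta})$ denotes the inverse of the matrix $(g_{\alpha\bar\beta})$ of coefficients of $\omega=\sqrt{-1}\sum g_{\alpha\bar\beta}\,dz^\alpha\wedge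 d\bar z^\beta$, then $$|\partial\varphi|_\omega^2\equiv\frac{2n}{\mathsf K}\quad\text{on } V.$$ -/

import Mathlib

open scoped ContDiff

noncomputable section

namespace PolydiscPotential

/-- The unit polydisc `Δⁿ` in `ℂⁿ`. -/
def polydisc (n : ℕ) : Set (Fin n → ℂ) := {z | ∀ α, ‖z α‖ < 1}

/-- The Wirtinger derivative `∂f/∂z^α = (∂f/∂x^α - i ∂f/∂y^α) / 2`. -/
def dz {n : ℕ} (α : Fin n) (f : (Fin n → ℂ) → ℂ) (z : Fin n → ℂ) : ℂ :=
  (fderiv ℝ f z (Pi.single α 1) - Complex.I * fderiv ℝ f z (Pi.single α Complex.I)) / 2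

/-- The Wirtinger derivative `∂f/∂z̄^α = (∂f/∂x^α + i ∂f/∂y^α) / 2`. -/
def dzbar {n : ℕ} (α : Fin n) (f : (Fin n → ℂ) → ℂ) (z : Fin n → ℂ) : ℂ :=
  (fderiv ℝ f z (Pi.single α 1) + Complex.I * fderiv ℝ f z (Pi.single α Complex.I)) / 2

/-- A real function viewed as a complex valued one. -/
def toComplex {n : ℕ} (φ : (Fin n → ℂ) → ℝ) : (Fin n → ℂ) → ℂ := fun z => (φ z : ℂ)

/-- The coefficient matrix `φ_{αβ̄} = ∂²φ/∂z^α∂z̄^β` of the form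
`dd^c φ = √-1 ∂∂̄φ = √-1 ∑ φ_{αβ̄} dz^α ∧ dz̄^β`. -/
def complexHessian {n : ℕ} (φ : (Fin n → ℂ) → ℝ) (z : Fin n → ℂ) :
    Matrix (Fin n) (Fin n) ℂ :=
  Matrix.of fun α β => dz α (dzbar β (toComplex φ)) z

/-- `φ` is a local potential, on the open set `V`, of the form
`ω = √-1 ∑ g_{αβ̄} dz^α ∧ dz̄^β`: it is smooth on `V` and `dd^c φ = ω` there.
The entry `g z α β` is the coefficient `g_{αβ̄}` at `z`. -/
structure IsLocalPotential {n : ℕ} (g : (Fin n → ℂ) → Matrix (Fin n) (Fin n) ℂ)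
    (V : Set (Fin n → ℂ)) (φ : (Fin n → ℂ) → ℝ) : Prop where
  isOpen : IsOpen V
  contDiffOn : ContDiffOn ℝ ∞ φ V
  ddc_eq : ∀ z ∈ V, complexHessian φ z = g z

/-- The squared gradient length `|∂φ|²_ω = ∑ φ_α φ_{β̄} g^{αβ̄}`, where
`∑_γ g^{αγ̄} g_{βγ̄} = δ^α_β`, so that `g^{αβ̄}` is the `(β, α)` entry of the inverse
of the matrix `(g_{αβ̄})`. -/
def gradLengthSq {n : ℕ} (g : (Fin n → ℂ) → Matrix (Fin n) (Fin n) ℂ)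
    (φ : (Fin n → ℂ) → ℝ) (z : Fin n → ℂ) : ℂ :=
  ∑ α, ∑ β, dz α (toComplex φ) z * dzbar β (toComplex φ) z * (g z)⁻¹ β α

/-- The coefficient matrix of the complete Kähler–Einstein metric of `Δⁿ` with Ricci
curvature `-K`: `ω = √-1 ∑ 2 / (K (1 - |z^α|²)²) dz^α ∧ dz̄^α`. -/
def polydiscMetric (n : ℕ) (K : ℝ) (z : Fin n → ℂ) : Matrix (Fin n) (Fin n) ℂ :=
  Matrix.diagonal fun α => ((2 / (K * (1 - ‖z α‖ ^ 2) ^ 2) : ℝ) : ℂ)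

end PolydiscPotential

end

/-! This is a Bochner argument, applied to each disc factor separately. Write `P` for the gradient
`∂φ`, `h` for the inverse metric and `B` for the covariant Hessian `∇∂φ`, which is symmetric.
Applying `∂` to `|∂φ|² = C` gives `∑ hᵢ Bᵢⱼ P̄ᵢ = -Pⱼ`. Applying `∂̄` as well, and using that each
factor has curvature `-K`, shows that `∑ hᵢ Bᵢⱼ B̄ᵢₖ` is the diagonal matrix with entries `K|Pⱼ|² -
1/hⱼ`.

Evaluating this matrix on the gradient with the first identity, used twice, gives back the gradient,
so `hⱼ Pⱼ (K|Pⱼ|² - 1/hⱼ) = Pⱼ`. The matrix is a Gram matrix, so its diagonal is nonnegative; this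
excludes `Pⱼ = 0`. Hence `hⱼ|Pⱼ|² = 2/K` for every `j`, and the sum over `j` is `2n/K`.

`gradient_component_of_bochner` carries the algebra; `dz_gradLengthSq_eq_zero` and
`dzbar_dz_gradLengthSq_eq_zero` supply its two differentiated equations. -/

noncomputable section

namespace PolydiscPotential

open ComplexConjugate

/-! ### Pointwise linear algebra. -/

/-- The pointwise algebra behind the Bochner formula: `h` is the inverse metric, `e` its `∂`
derivative, `l` its `∂∂̄` derivative, `P` the gradient, `A` the `∂∂` Hessian and `X` the mixed
third derivatives of the potential. -/
theorem gradient_component_of_bochner {ι : Type*} [Fintype ι] [DecidableEq ι] {K : ℝ}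
    {h : ι → ℝ} (hpos : ∀ i, 0 < h i) {P e l : ι → ℂ} {A : ι → ι → ℂ} {X : ι → ι → ι → ℂ}
    (hA : ∀ i j, A i j = A j i)
    (hX : ∀ i j k, (h i : ℂ) * X i j k = -(if j = i then e i * (if k = i then (h i : ℂ)⁻¹ else 0) else 0))
    (hl : ∀ i, h i * l i - e i * conj (e i) = -(K * h i))
    (first : ∀ j, ∑ i, h i * A i j * conj (P i) + P j + e j * P j * conj (P j) = 0)
    (second : ∀ j k,
      ∑ i, (h i * A i j * conj (A i k) + h i * X i j k * conj (P i) +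
        (if k = i then conj (e i) else 0) * A i j * conj (P i)) +
      (if k = j then (h j : ℂ)⁻¹ else 0) +
      ((if k = j then l j else 0) * P j * conj (P j) +
        e j * (if k = j then (h j : ℂ)⁻¹ else 0) * conj (P j) +
        e j * P j * conj (A j k)) = 0) (j : ι) :
    (h j : ℂ) * (P j * conj (P j)) = ((2 / K : ℝ) : ℂ) := by
  have hne : ∀ i, (h i : ℂ) ≠ 0 := fun i => by exact_mod_cast (hpos i).ne'
  -- The Christoffel symbol of the metric `1/hᵢ` is `-eᵢ/hᵢ`, so this is the covariant Hessian.
  set B : ι → ι → ℂ := fun i j => A i j + if j = i then e i / h i * P i else 0 with hB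
  have hBs : ∀ i j, B i j = B j i := by
    intro i j
    simp only [hB, hA i j]
    by_cases hij : j = i
    · subst hij; rfl
    · simp [hij, Ne.symm hij]
  have first' : ∀ j, ∑ i, h i * B i j * conj (P i) = -P j := by
    intro j
    have h1 : ∑ i, h i * B i j * conj (P i)
        = ∑ i, h i * A i j * conj (P i) + e j * P j * conj (P j) := by
      simp only [hB, mul_add, add_mul, Finset.sum_add_distrib, mul_ite, ite_mul, mul_zero,
        zero_mul, Finset.sum_ite_eq, Finset.mem_univ, if_true]
      have := hne j
      field_simp
    rw [h1]
    linear_combination first j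
  have second' : ∀ j k, ∑ i, h i * B i j * conj (B i k)
      = if k = j then K * P j * conj (P j) - (h j : ℂ)⁻¹ else 0 := by
    intro j k
    have h1 : ∑ i, h i * B i j * conj (B i k)
        = ∑ i, h i * A i j * conj (A i k) + conj (e k) * A k j * conj (P k)
          + e j * P j * conj (A j k)
          + if k = j then e j * conj (e j) * (h j : ℂ)⁻¹ * P j * conj (P j) else 0 := by
      have h2 : ∀ i, h i * B i j * conj (B i k) = h i * A i j * conj (A i k)
          + (if k = i then conj (e i) * A i j * conj (P i) else 0)
          + (if j = i then e i * P i * conj (A i k) else 0)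
          + if j = i then (if k = i then e i * conj (e i) * (h i : ℂ)⁻¹ * P i * conj (P i) else 0)
              else 0 := by
        intro i
        have := hne i
        simp only [hB]
        split_ifs <;> simp <;> field_simp <;> ring
      simp only [h2, Finset.sum_add_distrib, Finset.sum_ite_eq, Finset.mem_univ, if_true]
    -- By `hX` the third derivatives survive only on the diagonal, where they cancel the derivative
    -- of `Pⱼ` inside `eⱼ Pⱼ P̄ⱼ` in `second`.
    have h3 : ∑ i, (h i * A i j * conj (A i k) + h i * X i j k * conj (P i) +
        (if k = i then conj (e i) else 0) * A i j * conj (P i))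
        = ∑ i, h i * A i j * conj (A i k)
          - (if k = j then e j * (h j : ℂ)⁻¹ * conj (P j) else 0)
          + conj (e k) * A k j * conj (P k) := by
      simp only [hX, Finset.sum_add_distrib, neg_mul, ite_mul, zero_mul, mul_ite, mul_zero,
        Finset.sum_neg_distrib, Finset.sum_ite_eq, Finset.mem_univ, if_true]
      ring
    have h4 := second j k
    rw [h3] at h4
    rw [h1]
    have := hne j
    by_cases hkj : k = j
    · subst hkj
      simp only [if_true] at h4 ⊢
      have h5 : l k = e k * conj (e k) * (h k : ℂ)⁻¹ - K := by
        field_simp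
        linear_combination hl k
      rw [h5] at h4
      linear_combination h4
    · simp only [hkj, if_false] at h4 ⊢
      linear_combination h4
  -- Pair `second'` with the vector `hₖ Pₖ`. Symmetry of `B` and the conjugate of `first'` evaluate
  -- the sum over `k`; `first'` itself then evaluates the sum over `i`.
  have eig : (h j : ℂ) * P j * (K * P j * conj (P j) - (h j : ℂ)⁻¹) = P j := by
    have h1 : ∑ k, (h k : ℂ) * P k * ∑ i, h i * B i j * conj (B i k)
        = (h j : ℂ) * P j * (K * P j * conj (P j) - (h j : ℂ)⁻¹) := by
      simp only [second', mul_ite, mul_zero, Finset.sum_ite_eq', Finset.mem_univ, if_true]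
    rw [← h1]
    simp only [Finset.mul_sum]
    rw [Finset.sum_comm]
    have h2 : ∀ i, ∑ k, (h k : ℂ) * P k * (h i * B i j * conj (B i k))
        = -(h i * B i j * conj (P i)) := by
      intro i
      have h3 := congrArg conj (first' i)
      simp only [map_sum, map_mul, Complex.conj_ofReal, Complex.conj_conj, map_neg] at h3
      have h4 : ∑ k, (h k : ℂ) * P k * (h i * B i j * conj (B i k))
          = (h i * B i j) * ∑ k, (h k : ℂ) * conj (B k i) * P k := by
        rw [Finset.mul_sum]
        refine Finset.sum_congr rfl fun k _ => ?_
        rw [hBs i k]; ring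
      rw [h4, h3]; ring
    rw [Finset.sum_congr rfl fun i _ => h2 i, Finset.sum_neg_distrib, first', neg_neg]
  have diag : 0 ≤ K * Complex.normSq (P j) - (h j)⁻¹ := by
    have h1 := second' j j
    have h2 : ∑ i, h i * B i j * conj (B i j)
        = ((∑ i, h i * Complex.normSq (B i j) : ℝ) : ℂ) := by
      push_cast
      refine Finset.sum_congr rfl fun i _ => ?_
      rw [mul_assoc, Complex.mul_conj]
    rw [h2, if_pos rfl, mul_assoc, Complex.mul_conj] at h1
    have h3 : (∑ i, h i * Complex.normSq (B i j) : ℝ)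
        = K * Complex.normSq (P j) - (h j)⁻¹ := by exact_mod_cast h1
    rw [← h3]
    exact Finset.sum_nonneg fun i _ => mul_nonneg (hpos i).le (Complex.normSq_nonneg _)
  have hP : P j ≠ 0 := by
    intro h0
    rw [h0] at diag
    have := hpos j
    simp at diag
    linarith
  -- The sign of `K` is not assumed here: `diag` with `K = 0` would give `1/hⱼ ≤ 0`.
  have hK : K ≠ 0 := by
    rintro rfl
    have := hpos j
    simp at diag
    linarith
  have hK' : (K : ℂ) ≠ 0 := by exact_mod_cast hK
  have h5 : (h j : ℂ) * (K * P j * conj (P j) - (h j : ℂ)⁻¹) = 1 :=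
    mul_left_cancel₀ hP (by linear_combination eig)
  have := hne j
  push_cast
  field_simp at h5 ⊢
  linear_combination h5

/-! ### Calculus of Wirtinger derivatives. -/

/-- The common form of the Wirtinger derivatives `∂/∂z^α` (`c = -i`) and `∂/∂z̄^α` (`c = i`). -/
def wirtinger {n : ℕ} (c : ℂ) (α : Fin n) (f : (Fin n → ℂ) → ℂ) (z : Fin n → ℂ) : ℂ :=
  (fderiv ℝ f z (Pi.single α 1) + c * fderiv ℝ f z (Pi.single α Complex.I)) / 2

variable {n : ℕ}

theorem dz_eq_wirtinger (α : Fin n) : dz α = wirtinger (-Complex.I) α := by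
  funext f z
  simp only [dz, wirtinger]
  ring

theorem dzbar_eq_wirtinger (α : Fin n) : dzbar α = wirtinger Complex.I α := rfl

theorem wirtinger_congr {c : ℂ} {α : Fin n} {f g : (Fin n → ℂ) → ℂ} {z : Fin n → ℂ}
    {V : Set (Fin n → ℂ)} (hV : IsOpen V) (hz : z ∈ V) (h : ∀ y ∈ V, f y = g y) :
    wirtinger c α f z = wirtinger c α g z := by
  have : f =ᶠ[nhds z] g := Filter.eventuallyEq_of_mem (hV.mem_nhds hz) h
  simp only [wirtinger, this.fderiv_eq]

theorem wirtinger_const (c : ℂ) (α : Fin n) (a : ℂ) (z : Fin n → ℂ) :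
    wirtinger c α (fun _ => a) z = 0 := by
  simp [wirtinger]

theorem wirtinger_add {c : ℂ} {α : Fin n} {f g : (Fin n → ℂ) → ℂ} {z : Fin n → ℂ}
    (hf : DifferentiableAt ℝ f z) (hg : DifferentiableAt ℝ g z) :
    wirtinger c α (fun y => f y + g y) z = wirtinger c α f z + wirtinger c α g z := by
  simp only [wirtinger, fderiv_fun_add hf hg, _root_.add_apply]
  ring

theorem wirtinger_mul {c : ℂ} {α : Fin n} {f g : (Fin n → ℂ) → ℂ} {z : Fin n → ℂ}
    (hf : DifferentiableAt ℝ f z) (hg : DifferentiableAt ℝ g z) :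
    wirtinger c α (fun y => f y * g y) z
      = wirtinger c α f z * g z + f z * wirtinger c α g z := by
  simp only [wirtinger, fderiv_fun_mul hf hg, _root_.add_apply,
    _root_.smul_apply, smul_eq_mul]
  ring

theorem wirtinger_sum {ι : Type*} {s : Finset ι} {c : ℂ} {α : Fin n}
    {f : ι → (Fin n → ℂ) → ℂ} {z : Fin n → ℂ} (hf : ∀ i ∈ s, DifferentiableAt ℝ (f i) z) :
    wirtinger c α (fun y => ∑ i ∈ s, f i y) z = ∑ i ∈ s, wirtinger c α (f i) z := by
  simp only [wirtinger, fderiv_fun_sum hf, _root_.sum_apply, Finset.mul_sum,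
    ← Finset.sum_add_distrib, Finset.sum_div]

/-- Since `conj` exchanges `c = -i` and `c = i`, this trades `∂` for `∂̄`. -/
theorem wirtinger_conj (c : ℂ) (α : Fin n) (f : (Fin n → ℂ) → ℂ) (z : Fin n → ℂ) :
    wirtinger c α (fun y => conj (f y)) z = conj (wirtinger (conj c) α f z) := by
  have h : fderiv ℝ (fun y => conj (f y)) z
      = (Complex.conjCLE : ℂ →L[ℝ] ℂ).comp (fderiv ℝ f z) :=
    Complex.conjCLE.comp_fderiv (f := f) (x := z)
  simp [wirtinger, h, map_ofNat]

theorem contDiffOn_wirtinger {c : ℂ} {α : Fin n} {f : (Fin n → ℂ) → ℂ}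
    {V : Set (Fin n → ℂ)} (hV : IsOpen V) (hf : ContDiffOn ℝ ∞ f V) :
    ContDiffOn ℝ ∞ (wirtinger c α f) V := by
  have h := hf.fderiv_of_isOpen hV (m := ∞) (by simp)
  unfold wirtinger
  exact ((h.clm_apply contDiffOn_const).add
    (contDiffOn_const.mul (h.clm_apply contDiffOn_const))).div_const _

/-- Both operators are constant-coefficient combinations of real directional derivatives, so
symmetry of the second real derivative suffices. -/
theorem wirtinger_comm {c d : ℂ} {α β : Fin n} {f : (Fin n → ℂ) → ℂ} {z : Fin n → ℂ}
    (hf : ContDiffAt ℝ 2 f z) :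
    wirtinger c α (wirtinger d β f) z = wirtinger d β (wirtinger c α f) z := by
  have hd : DifferentiableAt ℝ (fderiv ℝ f) z :=
    (hf.fderiv_right (m := 1) (by norm_num)).differentiableAt (by norm_num)
  have hs : IsSymmSndFDerivAt ℝ f z := hf.isSymmSndFDerivAt (by simp)
  have key : ∀ (b : ℂ) (γ : Fin n) (u : Fin n → ℂ), fderiv ℝ (wirtinger b γ f) z u
      = (fderiv ℝ (fderiv ℝ f) z u (Pi.single γ 1)
        + b * fderiv ℝ (fderiv ℝ f) z u (Pi.single γ Complex.I)) / 2 := by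
    intro b γ u
    have h1 : ∀ v, HasFDerivAt (fun y => fderiv ℝ f y v)
        ((ContinuousLinearMap.apply ℝ ℂ v).comp (fderiv ℝ (fderiv ℝ f) z)) z := fun v =>
      (ContinuousLinearMap.apply ℝ ℂ v).hasFDerivAt.comp z hd.hasFDerivAt
    have h2 := (((h1 (Pi.single γ 1)).add ((h1 (Pi.single γ Complex.I)).const_mul b)).mul_const
      (2⁻¹ : ℂ)).fderiv
    have h3 : wirtinger b γ f = fun y => (fderiv ℝ f y (Pi.single γ 1)
        + b * fderiv ℝ f y (Pi.single γ Complex.I)) * 2⁻¹ := by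
      funext y; simp [wirtinger, div_eq_mul_inv]
    rw [h3]
    refine (congrArg (fun L => L u) h2).trans ?_
    simp
    ring
  rw [wirtinger, wirtinger, key, key, key, key, hs.eq (Pi.single α 1) (Pi.single β 1),
    hs.eq (Pi.single α 1) (Pi.single β Complex.I), hs.eq (Pi.single α Complex.I) (Pi.single β 1),
    hs.eq (Pi.single α Complex.I) (Pi.single β Complex.I)]
  ring

theorem wirtinger_coord (c : ℂ) (α β : Fin n) (z : Fin n → ℂ) :
    wirtinger c α (fun y => y β) z = if α = β then (1 + c * Complex.I) / 2 else 0 := by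
  have h : fderiv ℝ (fun y : Fin n → ℂ => y β) z = ContinuousLinearMap.proj β :=
    (ContinuousLinearMap.proj (R := ℝ) (φ := fun _ : Fin n => ℂ) β).fderiv
  simp only [wirtinger, h, ContinuousLinearMap.proj_apply, Pi.single_apply, eq_comm (a := β)]
  split_ifs <;> simp

/-! ### The inverse polydisc metric and its derivatives. -/

/-- The inverse `g^{αᾱ}` of the polydisc metric, as a polynomial in `z^α` and its conjugate. -/
def invMetric (K : ℝ) (α : Fin n) (z : Fin n → ℂ) : ℂ := (K / 2) * (1 - z α * conj (z α)) ^ 2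

/-- The derivative `∂g^{αᾱ}/∂z^α`. -/
def dzInvMetric (K : ℝ) (α : Fin n) (z : Fin n → ℂ) : ℂ :=
  -K * ((1 - z α * conj (z α)) * conj (z α))

theorem contDiff_coord (α : Fin n) : ContDiff ℝ ∞ fun z : Fin n → ℂ => z α :=
  contDiff_apply ℝ ℂ α

theorem contDiff_conj_coord (α : Fin n) : ContDiff ℝ ∞ fun z : Fin n → ℂ => conj (z α) :=
  Complex.conjCLE.contDiff.comp (contDiff_coord α)

theorem contDiff_one_sub_normSq (α : Fin n) :
    ContDiff ℝ ∞ fun z : Fin n → ℂ => 1 - z α * conj (z α) :=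
  contDiff_const.sub ((contDiff_coord α).mul (contDiff_conj_coord α))

theorem contDiff_invMetric (K : ℝ) (α : Fin n) : ContDiff ℝ ∞ (invMetric K α) :=
  contDiff_const.mul ((contDiff_one_sub_normSq α).pow 2)

theorem contDiff_dzInvMetric (K : ℝ) (α : Fin n) : ContDiff ℝ ∞ (dzInvMetric K α) :=
  contDiff_const.mul ((contDiff_one_sub_normSq α).mul (contDiff_conj_coord α))

theorem differentiableAt_of_contDiff {f : (Fin n → ℂ) → ℂ} (hf : ContDiff ℝ ∞ f)
    (z : Fin n → ℂ) : DifferentiableAt ℝ f z :=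
  hf.differentiable (by simp) z

theorem wirtinger_conj_coord (c : ℂ) (α β : Fin n) (z : Fin n → ℂ) :
    wirtinger c α (fun y => conj (y β)) z = if α = β then (1 - c * Complex.I) / 2 else 0 := by
  rw [wirtinger_conj, wirtinger_coord]
  split_ifs <;> simp [map_ofNat, sub_eq_add_neg]

theorem wirtinger_one_sub_normSq (c : ℂ) (α β : Fin n) (z : Fin n → ℂ) :
    wirtinger c α (fun y => 1 - y β * conj (y β)) z
      = if α = β then -((1 + c * Complex.I) / 2 * conj (z β) + z β * ((1 - c * Complex.I) / 2))
        else 0 := by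
  have h1 : (fun y : Fin n → ℂ => 1 - y β * conj (y β))
      = fun y => 1 + -1 * (y β * conj (y β)) := by
    funext y; ring
  have d1 := differentiableAt_of_contDiff (contDiff_coord β) z
  have d2 := differentiableAt_of_contDiff (contDiff_conj_coord β) z
  rw [h1, wirtinger_add (by fun_prop) ((d1.fun_mul d2).const_mul _),
    wirtinger_mul (by fun_prop) (d1.fun_mul d2), wirtinger_mul d1 d2, wirtinger_const,
    wirtinger_const, wirtinger_coord, wirtinger_conj_coord]
  split_ifs <;> ring

theorem wirtinger_invMetric (K : ℝ) (c : ℂ) (α β : Fin n) (z : Fin n → ℂ) :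
    wirtinger c α (invMetric K β) z
      = if α = β then (1 + c * Complex.I) / 2 * dzInvMetric K β z
          + (1 - c * Complex.I) / 2 * conj (dzInvMetric K β z) else 0 := by
  have h1 : invMetric K β = fun y : Fin n → ℂ =>
      (K / 2) * ((1 - y β * conj (y β)) * (1 - y β * conj (y β))) := by
    funext y; simp only [invMetric]; ring
  have d1 := differentiableAt_of_contDiff (contDiff_one_sub_normSq β) z
  rw [h1, wirtinger_mul (by fun_prop) (d1.fun_mul d1), wirtinger_mul d1 d1, wirtinger_const,
    wirtinger_one_sub_normSq]
  split_ifs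
  · simp only [dzInvMetric, map_mul, map_neg, Complex.conj_ofReal, map_sub, map_one,
      Complex.conj_conj]
    ring
  · ring

theorem dz_invMetric (K : ℝ) (α β : Fin n) (z : Fin n → ℂ) :
    wirtinger (-Complex.I) α (invMetric K β) z = if α = β then dzInvMetric K β z else 0 := by
  simp [wirtinger_invMetric]

theorem dzbar_invMetric (K : ℝ) (α β : Fin n) (z : Fin n → ℂ) :
    wirtinger Complex.I α (invMetric K β) z
      = if α = β then conj (dzInvMetric K β z) else 0 := by
  simp [wirtinger_invMetric]

theorem dzbar_dzInvMetric (K : ℝ) (α β : Fin n) (z : Fin n → ℂ) :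
    wirtinger Complex.I α (dzInvMetric K β) z
      = if α = β then -K * (1 - 2 * (z β * conj (z β))) else 0 := by
  have d1 := differentiableAt_of_contDiff (contDiff_one_sub_normSq β) z
  have d2 := differentiableAt_of_contDiff (contDiff_conj_coord β) z
  have h1 : dzInvMetric K β = fun y : Fin n → ℂ =>
      -K * ((1 - y β * conj (y β)) * conj (y β)) := rfl
  rw [h1, wirtinger_mul (by fun_prop) (d1.fun_mul d2), wirtinger_mul d1 d2, wirtinger_const,
    wirtinger_one_sub_normSq, wirtinger_conj_coord]
  split_ifs
  · simp only [Complex.I_mul_I]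
    ring
  · ring

theorem invMetric_eq_ofReal (K : ℝ) (α : Fin n) (z : Fin n → ℂ) :
    invMetric K α z = ((K / 2 * (1 - ‖z α‖ ^ 2) ^ 2 : ℝ) : ℂ) := by
  rw [invMetric, Complex.mul_conj, Complex.normSq_eq_norm_sq]
  push_cast
  ring

theorem one_sub_norm_sq_pos {z : Fin n → ℂ} (hz : z ∈ polydisc n) (α : Fin n) :
    0 < 1 - ‖z α‖ ^ 2 := by
  have h1 := hz α
  nlinarith [norm_nonneg (z α)]

theorem polydiscMetric_eq {K : ℝ} (z : Fin n → ℂ) :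
    polydiscMetric n K z = Matrix.diagonal fun α => (invMetric K α z)⁻¹ := by
  unfold polydiscMetric
  congr 1
  funext α
  rw [invMetric_eq_ofReal, ← Complex.ofReal_inv]
  congr 1
  rw [div_mul_eq_mul_div, inv_div]

theorem invMetric_ne_zero {K : ℝ} (hK : 0 < K) {z : Fin n → ℂ} (hz : z ∈ polydisc n)
    (α : Fin n) : invMetric K α z ≠ 0 := by
  rw [invMetric_eq_ofReal]
  have := one_sub_norm_sq_pos hz α
  exact_mod_cast (by positivity : K / 2 * (1 - ‖z α‖ ^ 2) ^ 2 ≠ 0)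

theorem polydiscMetric_inv {K : ℝ} (hK : 0 < K) {z : Fin n → ℂ} (hz : z ∈ polydisc n) :
    (polydiscMetric n K z)⁻¹ = Matrix.diagonal fun α => invMetric K α z := by
  rw [polydiscMetric_eq]
  apply Matrix.inv_eq_right_inv
  rw [Matrix.diagonal_mul_diagonal, ← Matrix.diagonal_one]
  congr 1
  funext α
  exact inv_mul_cancel₀ (invMetric_ne_zero hK hz α)

theorem dzbar_toComplex (φ : (Fin n → ℂ) → ℝ) (α : Fin n) (z : Fin n → ℂ) :
    dzbar α (toComplex φ) z = conj (dz α (toComplex φ) z) := by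
  have h1 : toComplex φ = fun y => conj (toComplex φ y) := by
    funext y; simp [toComplex]
  rw [dz_eq_wirtinger, dzbar_eq_wirtinger]
  conv_lhs => rw [h1]
  rw [wirtinger_conj, Complex.conj_I]

theorem gradLengthSq_polydiscMetric {K : ℝ} (hK : 0 < K) (φ : (Fin n → ℂ) → ℝ)
    {z : Fin n → ℂ} (hz : z ∈ polydisc n) :
    gradLengthSq (polydiscMetric n K) φ z
      = ∑ α, invMetric K α z * (dz α (toComplex φ) z * conj (dz α (toComplex φ) z)) := by
  simp only [gradLengthSq, polydiscMetric_inv hK hz, dzbar_toComplex, Matrix.diagonal_apply,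
    mul_ite, mul_zero, Finset.sum_ite_eq', Finset.mem_univ, if_true]
  exact Finset.sum_congr rfl fun α _ => mul_comm _ _

/-! ### Differentiating the constant-length equation. -/

section Potential

variable {K : ℝ} {V : Set (Fin n → ℂ)} {φ : (Fin n → ℂ) → ℝ}

theorem IsLocalPotential.contDiffOn_toComplex {g : (Fin n → ℂ) → Matrix (Fin n) (Fin n) ℂ}
    (hφ : IsLocalPotential g V φ) : ContDiffOn ℝ ∞ (toComplex φ) V :=
  Complex.ofRealCLM.contDiff.comp_contDiffOn hφ.contDiffOn

theorem IsLocalPotential.dzbar_dz (hφ : IsLocalPotential (polydiscMetric n K) V φ)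
    {z : Fin n → ℂ} (hz : z ∈ V) (α β : Fin n) :
    wirtinger Complex.I β (dz α (toComplex φ)) z
      = if β = α then (invMetric K α z)⁻¹ else 0 := by
  -- As `φ` is real, conjugation turns `∂̄∂φ` into the `∂∂̄φ` of the hypothesis; the metric is real,
  -- so its entries are unchanged.
  have h1 : dz α (toComplex φ) = fun y => conj (dzbar α (toComplex φ) y) := by
    funext y; simp [dzbar_toComplex]
  have h2 : dz β (dzbar α (toComplex φ)) z = polydiscMetric n K z β α :=
    congrFun (congrFun (hφ.ddc_eq z hz) β) α
  rw [h1, wirtinger_conj, Complex.conj_I, ← dz_eq_wirtinger, h2, polydiscMetric_eq,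
    Matrix.diagonal_apply]
  split_ifs with h
  · rw [h, invMetric_eq_ofReal, ← Complex.ofReal_inv, Complex.conj_ofReal]
  · simp

variable (hK : 0 < K) (hV : V ⊆ polydisc n) (hφ : IsLocalPotential (polydiscMetric n K) V φ)
  {C : ℝ} (hC : ∀ z ∈ V, gradLengthSq (polydiscMetric n K) φ z = (C : ℂ))
include hK hV hφ hC

/-- The `∂` derivative of the equation `|∂φ|² = C`. -/
theorem dz_gradLengthSq_eq_zero {z : Fin n → ℂ} (hz : z ∈ V) (γ : Fin n) :
    ∑ α, invMetric K α z * wirtinger (-Complex.I) γ (dz α (toComplex φ)) z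
        * conj (dz α (toComplex φ) z) + dz γ (toComplex φ) z
      + dzInvMetric K γ z * dz γ (toComplex φ) z * conj (dz γ (toComplex φ) z) = 0 := by
  have hp : ∀ α, DifferentiableAt ℝ (dz α (toComplex φ)) z := fun α => by
    rw [dz_eq_wirtinger]
    exact ((contDiffOn_wirtinger hφ.isOpen hφ.contDiffOn_toComplex).contDiffAt
      (hφ.isOpen.mem_nhds hz)).differentiableAt (by simp)
  have hq : ∀ α, DifferentiableAt ℝ (fun y => conj (dz α (toComplex φ) y)) z := fun α =>
    Complex.conjCLE.differentiableAt.comp z (hp α)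
  have hh : ∀ α, DifferentiableAt ℝ (invMetric K α) z := fun α =>
    differentiableAt_of_contDiff (contDiff_invMetric K α) z
  have h0 := wirtinger_congr (c := -Complex.I) (α := γ) hφ.isOpen hz fun y hy =>
    (gradLengthSq_polydiscMetric hK φ (hV hy)).symm.trans (hC y hy)
  have hs : ∀ α ∈ Finset.univ, DifferentiableAt ℝ (fun y => invMetric K α y *
      (dz α (toComplex φ) y * conj (dz α (toComplex φ) y))) z :=
    fun α _ => (hh α).fun_mul ((hp α).fun_mul (hq α))
  rw [wirtinger_const, wirtinger_sum hs] at h0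
  have h1 : ∀ α, wirtinger (-Complex.I) γ (fun y => invMetric K α y *
        (dz α (toComplex φ) y * conj (dz α (toComplex φ) y))) z
      = invMetric K α z * wirtinger (-Complex.I) γ (dz α (toComplex φ)) z
        * conj (dz α (toComplex φ) z)
        + (if γ = α then dz α (toComplex φ) z else 0)
        + if γ = α then dzInvMetric K α z * dz α (toComplex φ) z * conj (dz α (toComplex φ) z)
          else 0 := by
    intro α
    rw [wirtinger_mul (hh α) ((hp α).fun_mul (hq α)), wirtinger_mul (hp α) (hq α), dz_invMetric,
      wirtinger_conj, map_neg, Complex.conj_I, neg_neg, hφ.dzbar_dz hz]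
    have := invMetric_ne_zero hK (hV hz) α
    split_ifs
    · rw [map_inv₀, invMetric_eq_ofReal, Complex.conj_ofReal, ← invMetric_eq_ofReal]
      field_simp
      ring
    · simp only [map_zero]; ring
  simpa only [h1, Finset.sum_add_distrib, Finset.sum_ite_eq, Finset.mem_univ, if_true] using h0

/-- The `∂̄` derivative of `dz_gradLengthSq_eq_zero`. -/
theorem dzbar_dz_gradLengthSq_eq_zero {z : Fin n → ℂ} (hz : z ∈ V) (γ δ : Fin n) :
    ∑ α, (invMetric K α z * wirtinger (-Complex.I) γ (dz α (toComplex φ)) z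
          * conj (wirtinger (-Complex.I) δ (dz α (toComplex φ)) z)
        + invMetric K α z
          * wirtinger Complex.I δ (wirtinger (-Complex.I) γ (dz α (toComplex φ))) z
          * conj (dz α (toComplex φ) z)
        + (if δ = α then conj (dzInvMetric K α z) else 0)
          * wirtinger (-Complex.I) γ (dz α (toComplex φ)) z * conj (dz α (toComplex φ) z))
      + (if δ = γ then (invMetric K γ z)⁻¹ else 0)
      + ((if δ = γ then -K * (1 - 2 * (z γ * conj (z γ))) else 0)
          * dz γ (toComplex φ) z * conj (dz γ (toComplex φ) z)
        + dzInvMetric K γ z * (if δ = γ then (invMetric K γ z)⁻¹ else 0)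
          * conj (dz γ (toComplex φ) z)
        + dzInvMetric K γ z * dz γ (toComplex φ) z
          * conj (wirtinger (-Complex.I) δ (dz γ (toComplex φ)) z)) = 0 := by
  have cp : ∀ α, ContDiffOn ℝ ∞ (dz α (toComplex φ)) V := fun α => by
    rw [dz_eq_wirtinger]
    exact contDiffOn_wirtinger hφ.isOpen hφ.contDiffOn_toComplex
  have diff : ∀ {f : (Fin n → ℂ) → ℂ}, ContDiffOn ℝ ∞ f V → DifferentiableAt ℝ f z := fun hf =>
    (hf.contDiffAt (hφ.isOpen.mem_nhds hz)).differentiableAt (by simp)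
  have hp := fun α => diff (cp α)
  have hA := fun α => diff (contDiffOn_wirtinger (c := -Complex.I) (α := γ) hφ.isOpen (cp α))
  have hq : ∀ α, DifferentiableAt ℝ (fun y => conj (dz α (toComplex φ) y)) z := fun α =>
    Complex.conjCLE.differentiableAt.comp z (hp α)
  have hh : ∀ α, DifferentiableAt ℝ (invMetric K α) z := fun α =>
    differentiableAt_of_contDiff (contDiff_invMetric K α) z
  have he : ∀ α, DifferentiableAt ℝ (dzInvMetric K α) z := fun α =>
    differentiableAt_of_contDiff (contDiff_dzInvMetric K α) z
  have hs : ∀ α ∈ Finset.univ, DifferentiableAt ℝ (fun y => invMetric K α y *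
      wirtinger (-Complex.I) γ (dz α (toComplex φ)) y * conj (dz α (toComplex φ) y)) z :=
    fun α _ => ((hh α).fun_mul (hA α)).fun_mul (hq α)
  have h0 := wirtinger_congr (c := Complex.I) (α := δ) hφ.isOpen hz fun y hy =>
    dz_gradLengthSq_eq_zero hK hV hφ hC hy γ
  rw [wirtinger_const,
    wirtinger_add ((DifferentiableAt.fun_sum hs).fun_add (hp γ)) (((he γ).fun_mul (hp γ)).fun_mul (hq γ)),
    wirtinger_add (DifferentiableAt.fun_sum hs) (hp γ), wirtinger_sum hs,
    wirtinger_mul ((he γ).fun_mul (hp γ)) (hq γ), wirtinger_mul (he γ) (hp γ), hφ.dzbar_dz hz,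
    dzbar_dzInvMetric, wirtinger_conj, Complex.conj_I] at h0
  refine Eq.trans ?_ h0
  congr 1
  · congr 1
    refine Finset.sum_congr rfl fun α _ => ?_
    rw [wirtinger_mul ((hh α).fun_mul (hA α)) (hq α), wirtinger_mul (hh α) (hA α), wirtinger_conj,
      Complex.conj_I, dzbar_invMetric]
    ring
  · ring

/-- Stronger than the total: constancy of the sum forces each disc factor to contribute exactly
`2/K`. -/
theorem gradLengthSq_component {z : Fin n → ℂ} (hz : z ∈ V) (γ : Fin n) :
    invMetric K γ z * (dz γ (toComplex φ) z * conj (dz γ (toComplex φ) z))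
      = ((2 / K : ℝ) : ℂ) := by
  have cp : ∀ α, ContDiffOn ℝ ∞ (dz α (toComplex φ)) V := fun α => by
    rw [dz_eq_wirtinger]
    exact contDiffOn_wirtinger hφ.isOpen hφ.contDiffOn_toComplex
  have diff : ∀ {f : (Fin n → ℂ) → ℂ}, ContDiffOn ℝ ∞ f V → DifferentiableAt ℝ f z := fun hf =>
    (hf.contDiffAt (hφ.isOpen.mem_nhds hz)).differentiableAt (by simp)
  have c2 : ∀ {f : (Fin n → ℂ) → ℂ}, ContDiffOn ℝ ∞ f V → ContDiffAt ℝ 2 f z := fun hf =>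
    contDiffAt_infty.1 (hf.contDiffAt (hφ.isOpen.mem_nhds hz)) 2
  have hpos : ∀ α, 0 < K / 2 * (1 - ‖z α‖ ^ 2) ^ 2 := fun α => by
    have := one_sub_norm_sq_pos (hV hz) α
    positivity
  rw [invMetric_eq_ofReal]
  refine gradient_component_of_bochner hpos
    (e := fun α => dzInvMetric K α z) (l := fun α => -K * (1 - 2 * (z α * conj (z α))))
    (P := fun α => dz α (toComplex φ) z)
    (A := fun α γ => wirtinger (-Complex.I) γ (dz α (toComplex φ)) z)
    (X := fun α γ δ => wirtinger Complex.I δ (wirtinger (-Complex.I) γ (dz α (toComplex φ))) z)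
    ?_ ?_ ?_ ?_ ?_ γ
  · intro α β
    simp only [dz_eq_wirtinger]
    exact wirtinger_comm (c2 hφ.contDiffOn_toComplex)
  · intro α β δ
    rw [← invMetric_eq_ofReal, wirtinger_comm (c2 (cp α))]
    -- Differentiating this constant product gives the third derivatives of `φ` without
    -- differentiating an inverse.
    have h1 : ∀ y ∈ V, invMetric K α y * wirtinger Complex.I δ (dz α (toComplex φ)) y
        = if δ = α then 1 else 0 := by
      intro y hy
      rw [hφ.dzbar_dz hy]
      split_ifs
      · exact mul_inv_cancel₀ (invMetric_ne_zero hK (hV hy) α)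
      · ring
    have h2 := wirtinger_congr (c := -Complex.I) (α := β) hφ.isOpen hz h1
    rw [wirtinger_const,
      wirtinger_mul (differentiableAt_of_contDiff (contDiff_invMetric K α) z)
      (diff (contDiffOn_wirtinger hφ.isOpen (cp α))), dz_invMetric, hφ.dzbar_dz hz] at h2
    rw [eq_neg_iff_add_eq_zero, add_comm]
    refine Eq.trans ?_ h2
    split_ifs <;> ring
  -- The Einstein condition in one disc: `h ∂∂̄h - |∂h|² = -K h`, that is `∂∂̄ log h = -K/h`.
  · intro α
    simp only [← invMetric_eq_ofReal, invMetric, dzInvMetric, map_mul, map_neg,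
      Complex.conj_ofReal, map_sub, map_one, Complex.conj_conj]
    ring
  · intro β
    simp only [← invMetric_eq_ofReal]
    exact dz_gradLengthSq_eq_zero hK hV hφ hC hz β
  · intro β δ
    simp only [← invMetric_eq_ofReal]
    exact dzbar_dz_gradLengthSq_eq_zero hK hV hφ hC hz β δ

end Potential

end PolydiscPotential

end

theorem proposition3p1 (n : ℕ) (K : ℝ) (hK : 0 < K)
    (V : Set (Fin n → ℂ)) (hV : V ⊆ PolydiscPotential.polydisc n)
    (φ : (Fin n → ℂ) → ℝ)
    (hφ : PolydiscPotential.IsLocalPotential (PolydiscPotential.polydiscMetric n K) V φ)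
    (hconst : ∃ C : ℝ, ∀ z ∈ V,
      PolydiscPotential.gradLengthSq (PolydiscPotential.polydiscMetric n K) φ z = (C : ℂ)) :
    ∀ z ∈ V, PolydiscPotential.gradLengthSq (PolydiscPotential.polydiscMetric n K) φ z
      = ((2 * n / K : ℝ) : ℂ) := by
  obtain ⟨C, hC⟩ := hconst
  intro z hz
  rw [PolydiscPotential.gradLengthSq_polydiscMetric hK φ (hV hz),
    Finset.sum_congr rfl fun γ _ =>
      PolydiscPotential.gradLengthSq_component hK hV hφ hC hz γ]
  simp only [Finset.sum_const, Finset.card_univ, Fintype.card_fin, nsmul_eq_mul]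
  push_cast
  ring
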